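/- A contextuality scenario is a pair $\mathbb{G}=(V,E)$, where $V$ is a finite set and $E$ is a non-empty set of subsets of $V$ with $\bigcup_{e\in E}e=V$. A probabilistic model of $\mathbb{G}$ is a function $p:V\to[0,1]$ with $\sum_{x\in e}p(x)=1$ for all $e\in E$; the set of these is $\mathcal{G}(\mathbb{G})$, and $\mathbb{G}$ is non-trivial if $\mathcal{G}(\mathbb{G})\neq\emptyset$. Let $\mathcal{S}=\bigoplus_{e\in E}\ell^\infty_e$ (with its usual operator system structure, $\ell^\infty_e=\mathbb{C}^e$), let $\tilde{\mathcal{J}}_{\mathbb{G}}=\{u\in\mathcal{S}:\sum_{e\in E}\sum_{x\in e}p(x)u^e_x=0\text{ for all }p\in\mathcal{G}(\mathbb{G})\}$, let $\mathcal{S}_{\mathbb{G}}=\mathcal{S}/\tilde{\mathcal{J}}_{\mathbb{G}}$ be the operator system quotient, with quotient map $q$, and let $a_x=|E|\,q(\delta^e_x)$ for $x\in e\in E$, where $\delta^e_x$ is the canonical basis vector of the summand $\ell^\infty_e$ (this does not depend on the choice of $e$). Here $u\in M_n(\mathcal{S}/\tilde{\mathcal{J}}_{\mathbb{G}})$ is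 positive if, for every $\varepsilon>0$, $\varepsilon 1+u$ has a lift in $M_n(\mathcal{S})^+$. For operator systems $\mathcal{R},\mathcal{T}$, the cone $M_n(\mathcal{R}\otimes_{\max}\mathcal{T})^+$ consists of all $z\in M_n(\mathcal{R}\otimes\mathcal{T})$ such that for every $\varepsilon>0$ there are $k,m\in\mathbb{N}$, $P\in M_k(\mathcal{R})^+$, $Q\in M_m(\mathcal{T})^+$ and $\alpha\in M_{n,km}$ with $\varepsilon 1+z=\alpha(P\otimes Q)\alpha^*$. A state is a positive unital linear functional. Let $\mathbb{G}=(V,E)$ and $\mathbb{H}=(W,F)$ be non-trivial contextuality scenarios, let $a_x$ $(x\in V)$ and $b_y$ $(y\in W)$ be the canonical generators of $\mathcal{S}_{\mathbb{G}}$ and $\mathcal{S}_{\mathbb{H}}$, and let $\mathbb{G}\times\mathbb{H}=(V\times W,\{e\times f:e\in E,f\in F\})$. A probabilistic model $p$ of $\mathbb{G}\times\mathbb{H}$ is no-signalling if $\sum_{x\in e}p(x,y)=\sum_{x\in e'}p(x,y)$ for all $y\in W$, $e,e'\in E$, and $\sum_{y\in f}p(x,y)=\sum_{y\in f'}p(x,y)$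 for all $x\in V$, $f,f'\in F$; the set of these is $\mathcal{G}_{\rm ns}(\mathbb{G},\mathbb{H})$. For a linear functional $s$ on $\mathcal{S}_{\mathbb{G}}\otimes\mathcal{S}_{\mathbb{H}}$ put $p^s(x,y)=s(a_x\otimes b_y)$. Theorem. For every probabilistic model $p$ of $\mathbb{G}\times\mathbb{H}$ the following are equivalent: (i) $p\in\mathcal{G}_{\rm ns}(\mathbb{G},\mathbb{H})$; (ii) there is a state $s$ of $\mathcal{S}_{\mathbb{G}}\otimes_{\max}\mathcal{S}_{\mathbb{H}}$ with $p=p^s$. Moreover, the map $s\mapsto p^s$ is an affine isomorphism (a bijection preserving convex combinations between convex sets) from the state space of $\mathcal{S}_{\mathbb{G}}\otimes_{\max}\mathcal{S}_{\mathbb{H}}$ onto $\mathcal{G}_{\rm ns}(\mathbb{G},\mathbb{H})$. -/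

import Mathlib

noncomputable section

open scoped TensorProduct ComplexOrder

/-! ### Matrix orderings, states, quotients and maximal tensor products -/

section OperatorSystems

/-- A family of sets of `n × n` matrices over `S`, `n ∈ ℕ`; used for the matricial cones
`M_n(S)⁺` of an operator system `S`. -/
abbrev MatrixCones (S : Type*) := (n : ℕ) → Set (Matrix (Fin n) (Fin n) S)

/-- The positive elements of `S` itself, i.e. the first cone `M_1(S)⁺ = S⁺`. -/
def positiveElements {S : Type*} (C : MatrixCones S) : Set S :=
  {x | (Matrix.of fun _ _ : Fin 1 => x) ∈ C 1}

/-- The Archimedeanization of a family of cones with respect to the matrix order unit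
determined by `e`: all `u` with `ε (I_n ⊗ e) + u ∈ D_n` for every `ε > 0`. -/
def archimedeanization {S : Type*} [AddCommGroup S] [Module ℂ S] (D : MatrixCones S) (e : S) :
    MatrixCones S :=
  fun n => {u | ∀ ε : ℝ, 0 < ε → (ε : ℂ) • Matrix.diagonal (fun _ : Fin n => e) + u ∈ D n}

/-- The matricial cones of the operator system quotient `S / J`:
`u ∈ M_n(S / J)` is positive if, for every `ε > 0`, the element `ε 1 + u` has a positive lift
in `M_n(S)`. -/
def quotientCones {S : Type*} [AddCommGroup S] [Module ℂ S] (C : MatrixCones S) (e : S)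
    (J : Submodule ℂ S) : MatrixCones (S ⧸ J) :=
  archimedeanization (fun n => (fun v => v.map J.mkQ) '' C n) (J.mkQ e)

/-- The element `α (P ⊗ Q) α*` of `M_n(S ⊗ T)`, where `P ∈ M_k(S)`, `Q ∈ M_m(T)` and
`α` is a scalar `n × km` matrix. -/
def compressedTensor {S T : Type*} [AddCommGroup S] [Module ℂ S] [AddCommGroup T] [Module ℂ T]
    {n k m : ℕ} (α : Matrix (Fin n) (Fin k × Fin m) ℂ)
    (P : Matrix (Fin k) (Fin k) S) (Q : Matrix (Fin m) (Fin m) T) :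
    Matrix (Fin n) (Fin n) (S ⊗[ℂ] T) :=
  Matrix.of fun i j => ∑ a : Fin k × Fin m, ∑ b : Fin k × Fin m,
    (α i a * star (α j b)) • (P a.1 b.1 ⊗ₜ[ℂ] Q a.2 b.2)

/-- The matricial cones of the maximal tensor product `S ⊗_max T`: the Archimedeanization of
the family `D_n = {α (P ⊗ Q) α* : P ∈ M_k(S)⁺, Q ∈ M_m(T)⁺, α ∈ M_{n,km}, k, m ∈ ℕ}`. -/
def maxTensorCones {S T : Type*} [AddCommGroup S] [Module ℂ S] [AddCommGroup T] [Module ℂ T]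
    (C : MatrixCones S) (e : S) (D : MatrixCones T) (f : T) : MatrixCones (S ⊗[ℂ] T) :=
  archimedeanization
    (fun n => {z | ∃ (k m : ℕ), ∃ P ∈ C k, ∃ Q ∈ D m, ∃ α : Matrix (Fin n) (Fin k × Fin m) ℂ,
      z = compressedTensor α P Q})
    (e ⊗ₜ[ℂ] f)

/-- The state space: all positive unital linear functionals. -/
def stateSpace {S : Type*} [AddCommGroup S] [Module ℂ S] (C : MatrixCones S) (e : S) :
    Set (S →ₗ[ℂ] ℂ) :=
  {s | s e = 1 ∧ ∀ x ∈ positiveElements C, 0 ≤ s x}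

/-- A map between subsets of real vector spaces is an affine isomorphism: both sets are convex,
the map is a bijection, and it preserves convex combinations. -/
def IsAffineIso {X Y : Type*} [AddCommGroup X] [Module ℝ X] [AddCommGroup Y] [Module ℝ Y]
    {K : Set X} {L : Set Y} (Φ : K → L) : Prop :=
  Convex ℝ K ∧ Convex ℝ L ∧ Function.Bijective Φ ∧
    ∀ (s t u : K) (c : ℝ), 0 ≤ c → c ≤ 1 → (u : X) = c • (s : X) + (1 - c) • (t : X) →
      (Φ u : Y) = c • (Φ s : Y) + (1 - c) • (Φ t : Y)

end OperatorSystems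

/-! ### Contextuality scenarios -/

/-- A contextuality scenario with outcome set `V`: a non-empty set `E` of subsets of `V`
(the measurements) that covers `V`. -/
structure ContextualityScenario (V : Type*) where
  edges : Finset (Finset V)
  edges_nonempty : edges.Nonempty
  exists_mem_edge : ∀ x : V, ∃ e ∈ edges, x ∈ e

namespace ContextualityScenario

variable {V W : Type*}

/-- The probabilistic models of `G`. -/
def models (G : ContextualityScenario V) : Set (V → ℝ) :=
  {p | (∀ x, 0 ≤ p x ∧ p x ≤ 1) ∧ ∀ e ∈ G.edges, ∑ x ∈ e, p x = 1}

/-- A scenario is non-trivial if it admits a probabilistic model. -/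
def IsNontrivial (G : ContextualityScenario V) : Prop := G.models.Nonempty

/-- The product scenario: outcomes `V × W`, measurements `e × f`. -/
def prod [DecidableEq V] [DecidableEq W] (G : ContextualityScenario V)
    (H : ContextualityScenario W) : ContextualityScenario (V × W) where
  edges := (G.edges ×ˢ H.edges).image fun ef => ef.1 ×ˢ ef.2
  edges_nonempty := (G.edges_nonempty.product H.edges_nonempty).image _
  exists_mem_edge := by
    rintro ⟨x, y⟩
    obtain ⟨e, he, hx⟩ := G.exists_mem_edge x
    obtain ⟨f, hf, hy⟩ := H.exists_mem_edge y
    exact ⟨e ×ˢ f, Finset.mem_image.2 ⟨(e, f), Finset.mem_product.2 ⟨he, hf⟩, rfl⟩,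
      Finset.mem_product.2 ⟨hx, hy⟩⟩

/-- The no-signalling probabilistic models of `G × H`. -/
def nsModels [DecidableEq V] [DecidableEq W] (G : ContextualityScenario V)
    (H : ContextualityScenario W) : Set (V × W → ℝ) :=
  {p | p ∈ (G.prod H).models ∧
    (∀ y : W, ∀ e ∈ G.edges, ∀ e' ∈ G.edges, ∑ x ∈ e, p (x, y) = ∑ x ∈ e', p (x, y)) ∧
    (∀ x : V, ∀ f ∈ H.edges, ∀ f' ∈ H.edges, ∑ y ∈ f, p (x, y) = ∑ y ∈ f', p (x, y))}

/-- The direct sum `⊕_{e ∈ E} ℓ^∞_e`. -/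
abbrev DirectSumSystem (G : ContextualityScenario V) : Type _ :=
  (e : {e // e ∈ G.edges}) → {x // x ∈ e.1} → ℂ

/-- The cones of `⊕_{e ∈ E} ℓ^∞_e`, where `M_n(⊕_e ℓ^∞_e) = ⊕_e ⊕_{x ∈ e} M_n`. -/
def directSumCones (G : ContextualityScenario V) : MatrixCones G.DirectSumSystem :=
  fun _ => {u | ∀ (e : {e // e ∈ G.edges}) (x : {x // x ∈ e.1}),
    (u.map fun v => v e x).PosSemidef}

/-- The pairing `⟨p, u⟩ = ∑_e ∑_{x ∈ e} p(x) u_x^e`, linear in `u`. -/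
def pairing (G : ContextualityScenario V) (p : V → ℝ) : G.DirectSumSystem →ₗ[ℂ] ℂ where
  toFun u := ∑ e : {e // e ∈ G.edges}, ∑ x : {x // x ∈ e.1}, (p x : ℂ) * u e x
  map_add' u v := by simp [mul_add, Finset.sum_add_distrib]
  map_smul' c u := by simp [Finset.mul_sum, mul_left_comm]

/-- The kernel of the quotient: all `u` with `⟨p, u⟩ = 0` for every probabilistic model `p`. -/
def modelKernel (G : ContextualityScenario V) : Submodule ℂ G.DirectSumSystem :=
  ⨅ p ∈ G.models, LinearMap.ker (G.pairing p)

/-- The underlying vector space of the universal operator system `S_G`, the quotient of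
`⊕_{e ∈ E} ℓ^∞_e` by `modelKernel`. -/
abbrev UniversalSystem (G : ContextualityScenario V) : Type _ :=
  G.DirectSumSystem ⧸ G.modelKernel

/-- The unit of `S_G`. -/
def universalUnit (G : ContextualityScenario V) : G.UniversalSystem :=
  G.modelKernel.mkQ 1

/-- The matricial cones of `S_G`. -/
def universalCones (G : ContextualityScenario V) : MatrixCones G.UniversalSystem :=
  quotientCones G.directSumCones 1 G.modelKernel

variable [DecidableEq V] [DecidableEq W]

/-- The element `δ_x^e` of the `e`-th summand, inside `⊕_{f ∈ E} ℓ^∞_f`. -/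
def delta (G : ContextualityScenario V) (e : {e // e ∈ G.edges}) (x : {x // x ∈ e.1}) :
    G.DirectSumSystem :=
  Pi.single e (Pi.single x 1)

/-- The canonical generator `a_x = |E| q(δ_x^e)` of `S_G`, for any measurement `e` with `x ∈ e`;
see `generator_eq` for the independence of `e`. -/
def generator (G : ContextualityScenario V) (x : V) : G.UniversalSystem :=
  (G.edges.card : ℂ) • G.modelKernel.mkQ
    (G.delta ⟨(G.exists_mem_edge x).choose, (G.exists_mem_edge x).choose_spec.1⟩
      ⟨x, (G.exists_mem_edge x).choose_spec.2⟩)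

theorem pairing_delta (G : ContextualityScenario V) (p : V → ℝ) (e : {e // e ∈ G.edges})
    (x : {x // x ∈ e.1}) : G.pairing p (G.delta e x) = p x := by
  show ∑ e' : {e // e ∈ G.edges}, ∑ x' : {x // x ∈ e'.1}, (p x' : ℂ) * G.delta e x e' x' = _
  rw [Finset.sum_eq_single e, Finset.sum_eq_single x]
  · simp [delta]
  · intro b _ hb
    simp [delta, hb]
  · simp
  · intro b _ hb
    simp [delta, Pi.single_eq_of_ne hb]
  · simp

theorem generator_eq (G : ContextualityScenario V) (x : V) (e : Finset V) (he : e ∈ G.edges)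
    (hx : x ∈ e) :
    G.generator x = (G.edges.card : ℂ) • G.modelKernel.mkQ (G.delta ⟨e, he⟩ ⟨x, hx⟩) := by
  unfold generator
  congr 1
  rw [← sub_eq_zero, ← map_sub, Submodule.mkQ_apply, Submodule.Quotient.mk_eq_zero, modelKernel]
  simp only [Submodule.mem_iInf, LinearMap.mem_ker, map_sub, pairing_delta, sub_self,
    implies_true]

/-- The states of the maximal tensor product `S_G ⊗_max S_H`. -/
def maxTensorStates (G : ContextualityScenario V) (H : ContextualityScenario W) :
    Set (G.UniversalSystem ⊗[ℂ] H.UniversalSystem →ₗ[ℂ] ℂ) :=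
  stateSpace (maxTensorCones G.universalCones G.universalUnit H.universalCones H.universalUnit)
    (G.universalUnit ⊗ₜ[ℂ] H.universalUnit)

/-- The function `p^s(x, y) = s(a_x ⊗ b_y)` of a linear functional `s` on `S_G ⊗ S_H`. -/
def modelOf (G : ContextualityScenario V) (H : ContextualityScenario W)
    (s : G.UniversalSystem ⊗[ℂ] H.UniversalSystem →ₗ[ℂ] ℂ) (z : V × W) : ℂ :=
  s (G.generator z.1 ⊗ₜ[ℂ] H.generator z.2)

end ContextualityScenario

end

noncomputable section

open scoped TensorProduct ComplexOrder Kronecker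

namespace ContextualityScenario

variable {V W : Type*}

/-! ### The universal system -/

/-! The elements `a_x ⊗ b_y` are positive, and generators over a measurement sum to the unit
(`sum_generator`). Hence a state gives non-negative numbers `p^s(x, y)` whose marginals, such as
`s(1 ⊗ b_y)`, do not mention the measurement summed over: this is no-signalling.

Conversely, `p` defines a bilinear form on the two direct sums (`jointForm`). Fixing one outcome
leaves a slice of `p` in the other variable; no-signalling gives the slice equal totals on all
measurements, so it is zero or a multiple of a model and kills the model kernel
(`pairing_eq_zero_of_sum_eq`). The form therefore descends to the quotients. It is a non-negative
combination of products of coordinate evaluations, so Kronecker products of positive semidefinite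
matrices make it positive (`jointForm_nonneg`); limits `ε → 0` absorb the Archimedeanizations in the
quotients and in the tensor product. Functionals are determined by their values on the spanning set
`a_x ⊗ b_y`, which gives injectivity. -/

theorem mem_modelKernel {G : ContextualityScenario V} {u : G.DirectSumSystem} :
    u ∈ G.modelKernel ↔ ∀ p ∈ G.models, G.pairing p u = 0 := by
  simp [modelKernel, Submodule.mem_iInf]

theorem pairing_apply (G : ContextualityScenario V) (p : V → ℝ) (u : G.DirectSumSystem) :
    G.pairing p u = ∑ e : {e // e ∈ G.edges}, ∑ x : {x // x ∈ e.1}, (p x : ℂ) * u e x := rfl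

theorem card_edges_ne_zero (G : ContextualityScenario V) : (G.edges.card : ℂ) ≠ 0 :=
  Nat.cast_ne_zero.2 (Finset.card_pos.2 G.edges_nonempty).ne'

/-- A non-negative function with the same total weight on every measurement annihilates the
model kernel, since it is zero or a multiple of a model. -/
theorem pairing_eq_zero_of_sum_eq (G : ContextualityScenario V) {q : V → ℝ} (hq : ∀ x, 0 ≤ q x)
    (hsum : ∀ e ∈ G.edges, ∀ e' ∈ G.edges, ∑ x ∈ e, q x = ∑ x ∈ e', q x)
    {u : G.DirectSumSystem} (hu : u ∈ G.modelKernel) : G.pairing q u = 0 := by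
  obtain ⟨e₀, he₀⟩ := G.edges_nonempty
  set c : ℝ := ∑ x ∈ e₀, q x with hc
  -- The measurements cover the outcomes and share the total `c`, so `c` bounds `q`; this makes `q /
  -- c` take values in `[0, 1]`.
  have hle : ∀ x, q x ≤ c := by
    intro x
    obtain ⟨e, he, hx⟩ := G.exists_mem_edge x
    rw [hc, hsum e₀ he₀ e he]
    exact Finset.single_le_sum (fun i _ => hq i) hx
  have hc0 : 0 ≤ c := Finset.sum_nonneg fun i _ => hq i
  rcases hc0.eq_or_lt with h0 | hpos
  · have hq0 : ∀ x, q x = 0 := fun x => le_antisymm (by simpa [← h0] using hle x) (hq x)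
    simp [pairing_apply, hq0]
  · have hmodel : (fun x => q x / c) ∈ G.models := by
      refine ⟨fun x => ⟨div_nonneg (hq x) hc0, (div_le_one hpos).2 (hle x)⟩, fun e he => ?_⟩
      rw [← Finset.sum_div, hsum e he e₀ he₀, ← hc, div_self hpos.ne']
    have hscale : G.pairing q u = (c : ℂ) * G.pairing (fun x => q x / c) u := by
      have hcc : (c : ℂ) ≠ 0 := Complex.ofReal_ne_zero.2 hpos.ne'
      simp only [pairing_apply, Finset.mul_sum]
      refine Finset.sum_congr rfl fun e _ => Finset.sum_congr rfl fun x _ => ?_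
      push_cast
      field_simp
    rw [hscale, mem_modelKernel.1 hu _ hmodel, mul_zero]

theorem pairing_one (G : ContextualityScenario V) {p : V → ℝ} (hp : p ∈ G.models) :
    G.pairing p 1 = G.edges.card := by
  have h : ∀ e : {e // e ∈ G.edges}, ∑ x : {x // x ∈ e.1}, (p x : ℂ) = 1 := by
    intro e
    rw [Finset.sum_coe_sort e.1 (fun x => (p x : ℂ)), ← Complex.ofReal_sum, hp.2 e.1 e.2,
      Complex.ofReal_one]
  rw [pairing_apply]
  simp only [Pi.one_apply, mul_one]
  rw [Finset.sum_congr rfl fun e _ => h e]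
  simp

/-- The image in the universal system of a matrix with positive lift is positive. -/
theorem map_mkQ_mem_universalCones (G : ContextualityScenario V) {n : ℕ}
    {P : Matrix (Fin n) (Fin n) G.DirectSumSystem} (hP : P ∈ G.directSumCones n) :
    P.map G.modelKernel.mkQ ∈ G.universalCones n := by
  intro ε hε
  refine ⟨(ε : ℂ) • Matrix.diagonal (fun _ => 1) + P, fun e x => ?_, ?_⟩
  · have h : ((ε : ℂ) • Matrix.diagonal (fun _ => (1 : G.DirectSumSystem)) + P).map
        (fun v => v e x) = (ε : ℂ) • (1 : Matrix (Fin n) (Fin n) ℂ) + P.map fun v => v e x := by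
      ext i j
      by_cases hij : i = j
      · subst hij; simp
      · simp [hij]
    rw [h]
    exact (Matrix.PosSemidef.one.smul (by exact_mod_cast hε.le)).add (hP e x)
  · ext i j
    by_cases hij : i = j
    · subst hij; simp
    · simp [hij]

/-! ### The state space -/

theorem convex_maxTensorStates (G : ContextualityScenario V) (H : ContextualityScenario W) :
    Convex ℝ (G.maxTensorStates H) := by
  rintro s ⟨hs1, hs⟩ t ⟨ht1, ht⟩ a b ha hb hab
  refine ⟨?_, fun z hz => ?_⟩
  · simp only [LinearMap.add_apply, LinearMap.smul_apply, hs1, ht1, Complex.real_smul, mul_one]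
    exact_mod_cast hab
  · simp only [LinearMap.add_apply, LinearMap.smul_apply, Complex.real_smul]
    exact add_nonneg (mul_nonneg (by exact_mod_cast ha) (hs z hz))
      (mul_nonneg (by exact_mod_cast hb) (ht z hz))

/-! ### The bilinear form of a function on outcome pairs -/

/-- The bilinear form `(u, v) ↦ (|E| |F|)⁻¹ ∑ p(x, y) u_x^e v_y^f`. -/
def jointForm (G : ContextualityScenario V) (H : ContextualityScenario W) (p : V × W → ℝ) :
    G.DirectSumSystem →ₗ[ℂ] H.DirectSumSystem →ₗ[ℂ] ℂ :=
  LinearMap.mk₂ ℂ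
    (fun u v => ((G.edges.card : ℂ) * H.edges.card)⁻¹ *
      ∑ i : (Σ e : {e // e ∈ G.edges}, {x // x ∈ e.1}) × (Σ f : {f // f ∈ H.edges}, {y // y ∈ f.1}),
        (p (i.1.2, i.2.2) : ℂ) * (u i.1.1 i.1.2 * v i.2.1 i.2.2))
    (fun u u' v => by simp [add_mul, mul_add, Finset.sum_add_distrib])
    (fun c u v => by simp [Finset.mul_sum, mul_left_comm, mul_assoc])
    (fun u v v' => by simp [mul_add, Finset.sum_add_distrib])
    (fun c u v => by simp [Finset.mul_sum, mul_left_comm])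

theorem jointForm_apply (G : ContextualityScenario V) (H : ContextualityScenario W)
    (p : V × W → ℝ) (u : G.DirectSumSystem) (v : H.DirectSumSystem) :
    G.jointForm H p u v = ((G.edges.card : ℂ) * H.edges.card)⁻¹ *
      ∑ i : (Σ e : {e // e ∈ G.edges}, {x // x ∈ e.1}) × (Σ f : {f // f ∈ H.edges}, {y // y ∈ f.1}),
        (p (i.1.2, i.2.2) : ℂ) * (u i.1.1 i.1.2 * v i.2.1 i.2.2) := rfl

/-- Exposes the slices `p (·, y)`, so that the form vanishes in `u` as soon as every slice pairs to
zero with `u`. -/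
theorem jointForm_eq_sum_left (G : ContextualityScenario V) (H : ContextualityScenario W)
    (p : V × W → ℝ) (u : G.DirectSumSystem) (v : H.DirectSumSystem) :
    G.jointForm H p u v = ((G.edges.card : ℂ) * H.edges.card)⁻¹ *
      ∑ j : (Σ f : {f // f ∈ H.edges}, {y // y ∈ f.1}),
        G.pairing (fun x => p (x, j.2)) u * v j.1 j.2 := by
  rw [jointForm_apply, Fintype.sum_prod_type_right]
  congr 1
  refine Finset.sum_congr rfl fun j _ => ?_
  rw [pairing_apply, ← Fintype.sum_sigma', Finset.sum_mul]
  exact Finset.sum_congr rfl fun i _ => (mul_assoc _ _ _).symm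

theorem jointForm_eq_sum_right (G : ContextualityScenario V) (H : ContextualityScenario W)
    (p : V × W → ℝ) (u : G.DirectSumSystem) (v : H.DirectSumSystem) :
    G.jointForm H p u v = ((G.edges.card : ℂ) * H.edges.card)⁻¹ *
      ∑ i : (Σ e : {e // e ∈ G.edges}, {x // x ∈ e.1}),
        u i.1 i.2 * H.pairing (fun y => p (i.2, y)) v := by
  rw [jointForm_apply, Fintype.sum_prod_type]
  congr 1
  refine Finset.sum_congr rfl fun i _ => ?_
  rw [pairing_apply, ← Fintype.sum_sigma', Finset.mul_sum]
  exact Finset.sum_congr rfl fun j _ => mul_left_comm _ _ _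

/-- At each pair of coordinates the double sum is the quadratic form of a Kronecker product of two
positive semidefinite matrices, weighted by a value of `p`. -/
theorem jointForm_nonneg (G : ContextualityScenario V) (H : ContextualityScenario W)
    {p : V × W → ℝ} (hp : ∀ z, 0 ≤ p z) {k m : ℕ}
    {P : Matrix (Fin k) (Fin k) G.DirectSumSystem} (hP : P ∈ G.directSumCones k)
    {Q : Matrix (Fin m) (Fin m) H.DirectSumSystem} (hQ : Q ∈ H.directSumCones m)
    (α : Fin k × Fin m → ℂ) :
    0 ≤ ∑ a, ∑ b, (α a * star (α b)) * G.jointForm H p (P a.1 b.1) (Q a.2 b.2) := by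
  have h : ∑ a, ∑ b, (α a * star (α b)) * G.jointForm H p (P a.1 b.1) (Q a.2 b.2) =
      ∑ i : (Σ e : {e // e ∈ G.edges}, {x // x ∈ e.1}) × (Σ f : {f // f ∈ H.edges}, {y // y ∈ f.1}),
        ((G.edges.card : ℂ) * H.edges.card)⁻¹ * (p (i.1.2, i.2.2) *
          ∑ a, ∑ b, α a * (P a.1 b.1 i.1.1 i.1.2 * Q a.2 b.2 i.2.1 i.2.2 * star (α b))) := by
    simp only [jointForm_apply, Finset.mul_sum]
    rw [Finset.sum_comm_cycle]
    refine Finset.sum_congr rfl fun i _ => Finset.sum_congr rfl fun a _ =>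
      Finset.sum_congr rfl fun b _ => ?_
    ring
  rw [h]
  refine Finset.sum_nonneg fun i _ => mul_nonneg ?_ (mul_nonneg ?_ ?_)
  · rw [← Nat.cast_mul]
    exact inv_nonneg.2 (Nat.cast_nonneg _)
  · exact_mod_cast hp _
  -- The quadratic form conjugates its left vector, hence `star α`.
  · have hK := ((hP i.1.1 i.1.2).kronecker (hQ i.2.1 i.2.2)).dotProduct_mulVec_nonneg (star α)
    simpa [dotProduct, Matrix.mulVec, Matrix.kroneckerMap_apply, Finset.mul_sum] using hK

/-! ### Generators of the universal system -/

variable [DecidableEq V] [DecidableEq W]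

/-- Every model pairs to `1` with `∑ x ∈ e, δ_x^e` and to `|E|` with the unit; the factor `|E|` in
the generators balances the two. -/
theorem sum_generator (G : ContextualityScenario V) {e : Finset V} (he : e ∈ G.edges) :
    ∑ x ∈ e, G.generator x = G.universalUnit := by
  have h : ∑ x ∈ e, G.generator x = G.modelKernel.mkQ
      ((G.edges.card : ℂ) • ∑ x : {x // x ∈ e}, G.delta ⟨e, he⟩ x) := by
    rw [← Finset.sum_coe_sort, map_smul, map_sum, Finset.smul_sum]
    exact Finset.sum_congr rfl fun x _ => G.generator_eq x e he x.2
  rw [h, universalUnit, ← sub_eq_zero, ← map_sub, Submodule.mkQ_apply,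
    Submodule.Quotient.mk_eq_zero, mem_modelKernel]
  intro p hp
  have h1 : ∑ x : {x // x ∈ e}, (p x : ℂ) = 1 := by
    rw [Finset.sum_coe_sort e (fun x => (p x : ℂ)), ← Complex.ofReal_sum, hp.2 e he,
      Complex.ofReal_one]
  simp only [map_sub, map_smul, map_sum, pairing_delta]
  rw [h1, G.pairing_one hp, smul_eq_mul, mul_one, sub_self]

/-- Linear maps out of the universal system agree if they agree on the generators. -/
theorem universalSystem_hom_ext (G : ContextualityScenario V) {M : Type*} [AddCommGroup M]
    [Module ℂ M] {φ ψ : G.UniversalSystem →ₗ[ℂ] M}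
    (h : ∀ x, φ (G.generator x) = ψ (G.generator x)) : φ = ψ := by
  apply Submodule.linearMap_qext
  refine LinearMap.pi_ext' fun e => LinearMap.pi_ext' fun x => LinearMap.ext_ring ?_
  have hx := h x
  rw [G.generator_eq x e.1 e.2 x.2, map_smul, map_smul] at hx
  exact smul_right_injective M G.card_edges_ne_zero hx

theorem delta_nonneg (G : ContextualityScenario V) (e : {e // e ∈ G.edges}) (x : {x // x ∈ e.1})
    (e' : {e // e ∈ G.edges}) (x' : {x // x ∈ e'.1}) : 0 ≤ G.delta e x e' x' := by
  unfold delta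
  by_cases he : e' = e
  · subst he
    by_cases hx : x' = x
    · subst hx; simp
    · simp [hx]
  · simp [Pi.single_eq_of_ne he]

/-- The matrix `diag(1, a_x)` is positive. -/
theorem diagonal_unit_generator_mem (G : ContextualityScenario V) (x : V) :
    Matrix.diagonal ![G.universalUnit, G.generator x] ∈ G.universalCones 2 := by
  obtain ⟨e, he, hx⟩ := G.exists_mem_edge x
  have h : Matrix.diagonal ![G.universalUnit, G.generator x] =
      (Matrix.diagonal ![1, (G.edges.card : ℂ) • G.delta ⟨e, he⟩ ⟨x, hx⟩]).map
        G.modelKernel.mkQ := by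
    rw [Matrix.diagonal_map (map_zero _)]
    congr 1
    ext i
    fin_cases i
    · rfl
    · simp [G.generator_eq x e he hx]
  rw [h]
  refine G.map_mkQ_mem_universalCones fun e' x' => ?_
  rw [Matrix.diagonal_map rfl, Matrix.posSemidef_diagonal_iff]
  intro i
  fin_cases i
  · simp
  · simpa using mul_nonneg (Nat.cast_nonneg _) (G.delta_nonneg ⟨e, he⟩ ⟨x, hx⟩ e' x')

/-! ### The model of a state -/

theorem generator_tmul_generator_mem (G : ContextualityScenario V) (H : ContextualityScenario W)
    (x : V) (y : W) :
    G.generator x ⊗ₜ[ℂ] H.generator y ∈ positiveElements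
      (maxTensorCones G.universalCones G.universalUnit H.universalCones H.universalUnit) := by
  intro ε hε
  refine ⟨2, 2, _, G.diagonal_unit_generator_mem x, _, H.diagonal_unit_generator_mem y,
    -- `diag(1, a_x) ⊗ diag(1, b_y)` has both `1 ⊗ 1` and `a_x ⊗ b_y` on its diagonal; this row
    -- picks them with weights `ε` and `1`, so `ε 1 + a_x ⊗ b_y` is a single compression.
    Matrix.of fun _ a => if a = (0, 0) then ((√ε : ℝ) : ℂ) else if a = (1, 1) then 1 else 0, ?_⟩
  have hsq : ((√ε : ℝ) : ℂ) * ((√ε : ℝ) : ℂ) = ε := by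
    rw [← Complex.ofReal_mul, Real.mul_self_sqrt hε.le]
  ext i j
  obtain rfl : i = j := Subsingleton.elim _ _
  simp [compressedTensor, Fintype.sum_prod_type, hsq]
  rfl

theorem modelOf_nonneg (G : ContextualityScenario V) (H : ContextualityScenario W)
    {s : G.UniversalSystem ⊗[ℂ] H.UniversalSystem →ₗ[ℂ] ℂ} (hs : s ∈ G.maxTensorStates H)
    (z : V × W) : 0 ≤ G.modelOf H s z :=
  hs.2 _ (G.generator_tmul_generator_mem H z.1 z.2)

/-- The right-hand side is free of `e`, which is one half of no-signalling. -/
theorem sum_modelOf_left (G : ContextualityScenario V) (H : ContextualityScenario W)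
    (s : G.UniversalSystem ⊗[ℂ] H.UniversalSystem →ₗ[ℂ] ℂ) {e : Finset V} (he : e ∈ G.edges)
    (y : W) : ∑ x ∈ e, G.modelOf H s (x, y) = s (G.universalUnit ⊗ₜ[ℂ] H.generator y) := by
  rw [← G.sum_generator he, TensorProduct.sum_tmul, map_sum]
  rfl

theorem sum_modelOf_right (G : ContextualityScenario V) (H : ContextualityScenario W)
    (s : G.UniversalSystem ⊗[ℂ] H.UniversalSystem →ₗ[ℂ] ℂ) {f : Finset W} (hf : f ∈ H.edges)
    (x : V) : ∑ y ∈ f, G.modelOf H s (x, y) = s (G.generator x ⊗ₜ[ℂ] H.universalUnit) := by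
  rw [← H.sum_generator hf, TensorProduct.tmul_sum, map_sum]
  rfl

theorem sum_modelOf_product (G : ContextualityScenario V) (H : ContextualityScenario W)
    (s : G.UniversalSystem ⊗[ℂ] H.UniversalSystem →ₗ[ℂ] ℂ) {e : Finset V} (he : e ∈ G.edges)
    {f : Finset W} (hf : f ∈ H.edges) :
    ∑ z ∈ e ×ˢ f, G.modelOf H s z = s (G.universalUnit ⊗ₜ[ℂ] H.universalUnit) := by
  rw [Finset.sum_product_right, ← H.sum_generator hf, TensorProduct.tmul_sum, map_sum]
  exact Finset.sum_congr rfl fun y _ => G.sum_modelOf_left H s he y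

/-- The real-valued model of a state. -/
def realModelOf (G : ContextualityScenario V) (H : ContextualityScenario W)
    (s : G.UniversalSystem ⊗[ℂ] H.UniversalSystem →ₗ[ℂ] ℂ) (z : V × W) : ℝ :=
  (G.modelOf H s z).re

theorem ofReal_realModelOf (G : ContextualityScenario V) (H : ContextualityScenario W)
    {s : G.UniversalSystem ⊗[ℂ] H.UniversalSystem →ₗ[ℂ] ℂ} (hs : s ∈ G.maxTensorStates H)
    (z : V × W) : (G.realModelOf H s z : ℂ) = G.modelOf H s z :=
  (Complex.eq_re_of_ofReal_le (r := 0) (by simpa using G.modelOf_nonneg H hs z)).symm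

theorem realModelOf_mem_nsModels (G : ContextualityScenario V) (H : ContextualityScenario W)
    {s : G.UniversalSystem ⊗[ℂ] H.UniversalSystem →ₗ[ℂ] ℂ} (hs : s ∈ G.maxTensorStates H) :
    G.realModelOf H s ∈ G.nsModels H := by
  have hnonneg : ∀ z, 0 ≤ G.realModelOf H s z := fun z =>
    (Complex.nonneg_iff.1 (G.modelOf_nonneg H hs z)).1
  have hsum : ∀ g ∈ (G.prod H).edges, ∑ z ∈ g, G.realModelOf H s z = 1 := by
    intro g hg
    obtain ⟨⟨e, f⟩, hef, rfl⟩ := Finset.mem_image.1 hg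
    obtain ⟨he, hf⟩ := Finset.mem_product.1 hef
    simp only [realModelOf]
    rw [← Complex.re_sum, G.sum_modelOf_product H s he hf, hs.1, Complex.one_re]
  refine ⟨⟨fun z => ⟨hnonneg z, ?_⟩, hsum⟩, fun y e he e' he' => ?_, fun x f hf f' hf' => ?_⟩
  · obtain ⟨g, hg, hz⟩ := (G.prod H).exists_mem_edge z
    rw [← hsum g hg]
    exact Finset.single_le_sum (fun i _ => hnonneg i) hz
  · simp only [realModelOf]
    rw [← Complex.re_sum, ← Complex.re_sum, G.sum_modelOf_left H s he,
      G.sum_modelOf_left H s he']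
  · simp only [realModelOf]
    rw [← Complex.re_sum, ← Complex.re_sum, G.sum_modelOf_right H s hf,
      G.sum_modelOf_right H s hf']

/-! ### The state of a no-signalling model -/

theorem jointForm_delta (G : ContextualityScenario V) (H : ContextualityScenario W)
    (p : V × W → ℝ) (e : {e // e ∈ G.edges}) (x : {x // x ∈ e.1})
    (f : {f // f ∈ H.edges}) (y : {y // y ∈ f.1}) :
    G.jointForm H p (G.delta e x) (H.delta f y) =
      ((G.edges.card : ℂ) * H.edges.card)⁻¹ * p (x, y) := by
  have h := H.pairing_delta (fun y => p (x, y)) f y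
  rw [pairing_apply, ← Fintype.sum_sigma'] at h
  rw [jointForm_eq_sum_left, ← h]
  simp only [pairing_delta]

/-- The functional on `S_G ⊗ S_H` induced by a no-signalling model. -/
def nsFunctional (G : ContextualityScenario V) (H : ContextualityScenario W) {p : V × W → ℝ}
    (hp : p ∈ G.nsModels H) : G.UniversalSystem ⊗[ℂ] H.UniversalSystem →ₗ[ℂ] ℂ :=
  -- The form is factored through one quotient at a time, with `flip` exchanging the variables; each
  -- factorization uses one of the two no-signalling conditions.
  TensorProduct.lift (H.modelKernel.liftQ
    (G.modelKernel.liftQ (G.jointForm H p) (fun u hu => LinearMap.ext fun v => by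
      rw [jointForm_eq_sum_left, Finset.sum_eq_zero, mul_zero, LinearMap.zero_apply]
      intro j _
      rw [G.pairing_eq_zero_of_sum_eq (fun x => (hp.1.1 _).1) (hp.2.1 j.2) hu, zero_mul])).flip
    (fun v hv => Submodule.linearMap_qext _ <| LinearMap.ext fun u => by
      show G.jointForm H p u v = 0
      rw [jointForm_eq_sum_right, Finset.sum_eq_zero, mul_zero]
      intro i _
      rw [H.pairing_eq_zero_of_sum_eq (fun y => (hp.1.1 _).1) (hp.2.2 i.2) hv, mul_zero])).flip

theorem nsFunctional_mkQ_tmul_mkQ (G : ContextualityScenario V) (H : ContextualityScenario W)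
    {p : V × W → ℝ} (hp : p ∈ G.nsModels H) (u : G.DirectSumSystem) (v : H.DirectSumSystem) :
    G.nsFunctional H hp (G.modelKernel.mkQ u ⊗ₜ[ℂ] H.modelKernel.mkQ v) = G.jointForm H p u v :=
  rfl

theorem modelOf_nsFunctional (G : ContextualityScenario V) (H : ContextualityScenario W)
    {p : V × W → ℝ} (hp : p ∈ G.nsModels H) (z : V × W) :
    G.modelOf H (G.nsFunctional H hp) z = p z := by
  have hG := G.card_edges_ne_zero
  have hH := H.card_edges_ne_zero
  rw [modelOf, generator, generator, TensorProduct.smul_tmul_smul, map_smul,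
    nsFunctional_mkQ_tmul_mkQ, jointForm_delta, smul_eq_mul,
    mul_inv_cancel_left₀ (mul_ne_zero hG hH)]

/-- Only `ε 1 + P` and `ε 1 + Q` have positive lifts. `F ε` is the value with these in place of `P`
and `Q`, a polynomial in `ε`, so non-negativity passes to `F 0`. -/
theorem nsFunctional_compressedTensor_nonneg (G : ContextualityScenario V)
    (H : ContextualityScenario W) {p : V × W → ℝ} (hp : p ∈ G.nsModels H) {k m : ℕ}
    {P : Matrix (Fin k) (Fin k) G.UniversalSystem} (hP : P ∈ G.universalCones k)
    {Q : Matrix (Fin m) (Fin m) H.UniversalSystem} (hQ : Q ∈ H.universalCones m)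
    {n : ℕ} (α : Matrix (Fin n) (Fin k × Fin m) ℂ) (i : Fin n) :
    0 ≤ G.nsFunctional H hp (compressedTensor α P Q i i) := by
  set s := G.nsFunctional H hp
  let I : Matrix (Fin k) (Fin k) G.UniversalSystem :=
    Matrix.diagonal fun _ => G.modelKernel.mkQ 1
  let I' : Matrix (Fin m) (Fin m) H.UniversalSystem :=
    Matrix.diagonal fun _ => H.modelKernel.mkQ 1
  let F : ℝ → ℂ := fun ε => ∑ a, ∑ b, (α i a * star (α i b)) *
    ((ε : ℂ) * (ε : ℂ) * s (I a.1 b.1 ⊗ₜ I' a.2 b.2) + (ε : ℂ) * s (I a.1 b.1 ⊗ₜ Q a.2 b.2) +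
      (ε : ℂ) * s (P a.1 b.1 ⊗ₜ I' a.2 b.2) + s (P a.1 b.1 ⊗ₜ Q a.2 b.2))
  have hF : Continuous F := by fun_prop
  have hF0 : s (compressedTensor α P Q i i) = F 0 := by
    simp [F, compressedTensor]
  have hpos : ∀ ε : ℝ, 0 < ε → 0 ≤ F ε := by
    intro ε hε
    obtain ⟨P', hP', hPε⟩ := hP ε hε
    obtain ⟨Q', hQ', hQε⟩ := hQ ε hε
    convert G.jointForm_nonneg H (fun z => (hp.1.1 z).1) hP' hQ' (α i) using 5 with a _ b _
    have h₁ : G.modelKernel.mkQ (P' a.1 b.1) = (ε : ℂ) • I a.1 b.1 + P a.1 b.1 :=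
      congrFun (congrFun hPε a.1) b.1
    have h₂ : H.modelKernel.mkQ (Q' a.2 b.2) = (ε : ℂ) • I' a.2 b.2 + Q a.2 b.2 :=
      congrFun (congrFun hQε a.2) b.2
    rw [← G.nsFunctional_mkQ_tmul_mkQ H hp, h₁, h₂]
    simp only [TensorProduct.add_tmul, TensorProduct.tmul_add, ← TensorProduct.smul_tmul',
      TensorProduct.tmul_smul, map_add, map_smul, smul_eq_mul]
    ring
  rw [hF0]
  refine ge_of_tendsto ((hF.tendsto 0).mono_left nhdsWithin_le_nhds :
    Filter.Tendsto F (nhdsWithin 0 (Set.Ioi 0)) _) ?_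
  filter_upwards [self_mem_nhdsWithin] with ε hε using hpos ε hε

theorem nsFunctional_mem_maxTensorStates (G : ContextualityScenario V)
    (H : ContextualityScenario W) {p : V × W → ℝ} (hp : p ∈ G.nsModels H) :
    G.nsFunctional H hp ∈ G.maxTensorStates H := by
  have hunit : G.nsFunctional H hp (G.universalUnit ⊗ₜ[ℂ] H.universalUnit) = 1 := by
    obtain ⟨e, he⟩ := G.edges_nonempty
    obtain ⟨f, hf⟩ := H.edges_nonempty
    rw [← G.sum_modelOf_product H _ he hf]
    simp only [modelOf_nsFunctional]
    rw [← Complex.ofReal_sum, hp.1.2 (e ×ˢ f)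
      (Finset.mem_image.2 ⟨(e, f), Finset.mem_product.2 ⟨he, hf⟩, rfl⟩), Complex.ofReal_one]
  refine ⟨hunit, fun z hz => ?_⟩
  -- A second limit, for the Archimedeanization in the maximal tensor cone.
  have hpos : ∀ ε : ℝ, 0 < ε → 0 ≤ (ε : ℂ) + G.nsFunctional H hp z := by
    intro ε hε
    obtain ⟨k, m, P, hP, Q, hQ, α, h⟩ := hz ε hε
    have h' := congrFun (congrFun h 0) 0
    have := G.nsFunctional_compressedTensor_nonneg H hp hP hQ α 0
    rw [← h'] at this
    simpa only [Matrix.add_apply, Matrix.smul_apply, Matrix.diagonal_apply_eq, Matrix.of_apply,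
      map_add, map_smul, hunit, smul_eq_mul, mul_one] using this
  have hcont : Continuous fun ε : ℝ => (ε : ℂ) + G.nsFunctional H hp z := by fun_prop
  have hlim : Filter.Tendsto (fun ε : ℝ => (ε : ℂ) + G.nsFunctional H hp z)
      (nhdsWithin 0 (Set.Ioi 0)) (nhds (G.nsFunctional H hp z)) := by
    simpa using (hcont.tendsto 0).mono_left (nhdsWithin_le_nhds (s := Set.Ioi 0))
  refine ge_of_tendsto hlim ?_
  filter_upwards [self_mem_nhdsWithin] with ε hε using hpos ε hε

/-! ### Injectivity, and convexity of the no-signalling models -/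

theorem eq_of_modelOf_eq (G : ContextualityScenario V) (H : ContextualityScenario W)
    {s t : G.UniversalSystem ⊗[ℂ] H.UniversalSystem →ₗ[ℂ] ℂ}
    (h : ∀ z, G.modelOf H s z = G.modelOf H t z) : s = t := by
  refine TensorProduct.ext (G.universalSystem_hom_ext fun x => H.universalSystem_hom_ext fun y => ?_)
  exact h (x, y)

theorem convex_nsModels (G : ContextualityScenario V) (H : ContextualityScenario W) :
    Convex ℝ (G.nsModels H) := by
  rintro p ⟨⟨hp, hp1⟩, hpl, hpr⟩ q ⟨⟨hq, hq1⟩, hql, hqr⟩ a b ha hb hab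
  refine ⟨⟨fun z => ?_, fun g hg => ?_⟩, fun y e he e' he' => ?_, fun x f hf f' hf' => ?_⟩
  · have h := convex_Icc (𝕜 := ℝ) (0 : ℝ) 1 (hp z) (hq z) ha hb hab
    exact h
  · simp [Finset.sum_add_distrib, ← Finset.mul_sum, hp1 g hg, hq1 g hg, hab]
  · simp [Finset.sum_add_distrib, ← Finset.mul_sum, hpl y e he e' he', hql y e he e' he']
  · simp [Finset.sum_add_distrib, ← Finset.mul_sum, hpr x f hf f' hf', hqr x f hf f' hf']

end ContextualityScenario

end

theorem mainTheorem2 {V W : Type*} [Fintype V] [Fintype W] [DecidableEq V] [DecidableEq W]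
    (G : ContextualityScenario V) (H : ContextualityScenario W)
    (hG : G.IsNontrivial) (hH : H.IsNontrivial) :
    (∀ p ∈ (G.prod H).models,
      p ∈ G.nsModels H ↔
        ∃ s ∈ G.maxTensorStates H, ∀ z : V × W, G.modelOf H s z = (p z : ℂ)) ∧
    ∃ Φ : G.maxTensorStates H → G.nsModels H,
      (∀ (s : G.maxTensorStates H) (z : V × W), G.modelOf H s z = ((Φ s : V × W → ℝ) z : ℂ)) ∧
      IsAffineIso Φ := by
  refine ⟨fun p _ => ⟨fun hns => ⟨_, G.nsFunctional_mem_maxTensorStates H hns,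
    G.modelOf_nsFunctional H hns⟩, ?_⟩, ?_⟩
  · rintro ⟨s, hs, hsp⟩
    -- As `p` is real, it is recovered by taking real parts.
    have h : p = G.realModelOf H s := funext fun z => by simp [ContextualityScenario.realModelOf, hsp z]
    exact h ▸ G.realModelOf_mem_nsModels H hs
  · refine ⟨fun s => ⟨G.realModelOf H s.1, G.realModelOf_mem_nsModels H s.2⟩,
      fun s z => (G.ofReal_realModelOf H s.2 z).symm, G.convex_maxTensorStates H,
      G.convex_nsModels H, ⟨fun s t hst => Subtype.ext <| G.eq_of_modelOf_eq H fun z => ?_,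
        fun p => ⟨⟨_, G.nsFunctional_mem_maxTensorStates H p.2⟩, Subtype.ext <| funext fun z => ?_⟩⟩,
      fun s t u c _ _ hu => funext fun z => ?_⟩
    · rw [← G.ofReal_realModelOf H s.2, ← G.ofReal_realModelOf H t.2]
      exact congrArg _ (congrFun (congrArg Subtype.val hst) z)
    · simp [ContextualityScenario.realModelOf, ContextualityScenario.modelOf_nsFunctional]
    · simp [ContextualityScenario.realModelOf, ContextualityScenario.modelOf, hu]
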